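/- Let $B_r(x)$ denote the Bernoulli polynomials, defined by $\frac{te^{xt}}{e^t-1}=\sum_{r\ge0}B_r(x)\frac{t^r}{r!}$, and for $n\ge1$ let $$B_n^*(x)=\sum_{r=0}^{n}\binom{n+r}{2r}\frac{B_r(x)}{n+r}$$ be the Zagier polynomials. Let $x\in\mathbb R$. Then the generating function $$\sum_{n=0}^{\infty}B_{2n+1}^*(x)\,z^{2n+1},$$ regarded as a formal power series in $\mathbb R[[z]]$, is a rational function of $z$ (that is, equal to $P(z)/Q(z)$ for some polynomials $P,Q\in\mathbb R[z]$ with $Q\neq0$) if and only if $2x\in\mathbb Z$. -/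

import Mathlib

open scoped Polynomial PowerSeries

/-- The Zagier polynomial `B*_n(x) = ∑_{r=0}^{n} (n+r choose 2r) B_r(x) / (n+r)`, for `n > 0`,
where `B_r(x)` is the Bernoulli polynomial (`t e^{xt} / (e^t - 1) = ∑ B_r(x) t^r / r!`, so that
`B_1(x) = x - 1/2`). The value at `n = 0` plays no role. -/
noncomputable def zagierPolynomial (n : ℕ) : ℚ[X] :=
  ∑ r ∈ Finset.range (n + 1),
    Polynomial.C (((n + r).choose (2 * r) : ℚ) / ((n + r : ℕ) : ℚ)) * Polynomial.bernoulli r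

/-- The generating function `∑_{n ≥ 0} B*_{2n+1}(x) z^{2n+1}`, a formal power series in `z`. -/
noncomputable def oddZagierGenFun (x : ℝ) : ℝ⟦X⟧ :=
  PowerSeries.mk fun m => if Odd m then Polynomial.aeval x (zagierPolynomial m) else 0

/-- A formal power series is a rational function of its variable if it is the quotient `P / Q` of
two polynomials, `Q ≠ 0` (the identity `F = P / Q` holding in the field of Laurent series, that is,
`Q * F = P`). -/
def IsRationalFunction {K : Type*} [Field K] (F : K⟦X⟧) : Prop :=
  ∃ P Q : K[X], Q ≠ 0 ∧ (Q : K⟦X⟧) * F = (P : K⟦X⟧)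

/-! Let `U` send `X ^ r` to `B_r`. For n ≥ 1, 2n B*_n(x) = U(C_n)(x + 2), where C_n(t + 1/t) = t^n +
t^(-n). Write F_x for the generating function. As U(f)(x + 1) - U(f)(x) = f'(x) and C_n' = n
S_{n-1}, F_{x+1} - F_x is a Chebyshev series, hence rational: rationality depends only on x mod 1.
As C_n is odd for odd n, F_{-3-x} = -F_x. If 2x is an integer, x and -3-x differ by an integer, so
2F_x is rational.

Conversely, rational series have exponentially bounded coefficients. Expanding odd powers of X in
the C_n transfers such a bound to B_{2k+1}(y), y the fractional part of x. By its Fourier series,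
B_{2k+1}(y) has size about 2(2k+1)!/(2π)^(2k+1) |sin 2πy|, so sin 2πy = 0. -/

/-! ### Umbral calculus of Bernoulli polynomials -/

/-- The umbral map: the linear map sending `X ^ r` to the Bernoulli polynomial `B_r`. -/
noncomputable def bernoulliUmbral : ℚ[X] →ₗ[ℚ] ℚ[X] :=
  (Polynomial.basisMonomials ℚ).constr ℚ Polynomial.bernoulli

theorem bernoulliUmbral_X_pow (r : ℕ) :
    bernoulliUmbral (Polynomial.X ^ r) = Polynomial.bernoulli r := by
  have h := (Polynomial.basisMonomials ℚ).constr_basis ℚ Polynomial.bernoulli r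
  simp only [Polynomial.coe_basisMonomials, Polynomial.monomial_one_right_eq_X_pow] at h
  exact h

theorem linearMap_ext_X_pow {f g : ℚ[X] →ₗ[ℚ] ℚ[X]}
    (h : ∀ r : ℕ, f (Polynomial.X ^ r) = g (Polynomial.X ^ r)) : f = g := by
  refine (Polynomial.basisMonomials ℚ).ext fun r => ?_
  simpa only [Polynomial.coe_basisMonomials, Polynomial.monomial_one_right_eq_X_pow] using h r

/-- Composition with `q` on the right, as a linear map. -/
noncomputable def compLinearMap (q : ℚ[X]) : ℚ[X] →ₗ[ℚ] ℚ[X] where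
  toFun f := f.comp q
  map_add' _ _ := Polynomial.add_comp
  map_smul' _ _ := Polynomial.smul_comp ..

theorem compLinearMap_apply (q f : ℚ[X]) : compLinearMap q f = f.comp q := rfl

theorem bernoulliUmbral_comp_one_add_X_sub (f : ℚ[X]) :
    (bernoulliUmbral f).comp (1 + Polynomial.X) - bernoulliUmbral f =
      Polynomial.derivative f := by
  have h : compLinearMap (1 + Polynomial.X) ∘ₗ bernoulliUmbral - bernoulliUmbral =
      Polynomial.derivative := by
    refine linearMap_ext_X_pow fun r => ?_
    simp [compLinearMap_apply, bernoulliUmbral_X_pow, Polynomial.bernoulli_comp_one_add_X,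
      Polynomial.derivative_X_pow]
  simpa [compLinearMap_apply] using congr($h f)

theorem bernoulliUmbral_shift_sub (f : ℚ[X]) :
    bernoulliUmbral (f.comp (1 + Polynomial.X)) - bernoulliUmbral f =
      Polynomial.derivative f := by
  have h : bernoulliUmbral ∘ₗ compLinearMap (1 + Polynomial.X) - bernoulliUmbral =
      Polynomial.derivative := by
    refine linearMap_ext_X_pow fun r => ?_
    rcases r with _ | n
    · simp [compLinearMap_apply]
    · have h1 : ((1 : ℚ[X]) + Polynomial.X) ^ (n + 1) =
          ∑ k ∈ Finset.range (n + 1), ((n + 1).choose k : ℚ) • Polynomial.X ^ k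
            + Polynomial.X ^ (n + 1) := by
        rw [add_comm, add_pow, Finset.sum_range_succ]
        simp [mul_comm, Polynomial.smul_eq_C_mul]
      -- The binomial recurrence of the B_k is the claim on `X ^ (n + 1)`, with the top term
      -- cancelled.
      have h2 := Polynomial.sum_bernoulli n
      simp only [LinearMap.sub_apply, LinearMap.comp_apply, compLinearMap_apply,
        Polynomial.X_pow_comp, h1, map_add, map_sum, map_smul, bernoulliUmbral_X_pow, h2]
      rw [add_sub_cancel_right, Polynomial.derivative_X_pow, Polynomial.C_mul_X_pow_eq_monomial]
      simp
  simpa [compLinearMap_apply] using congr($h f)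

theorem bernoulliUmbral_comp_one_add_X (f : ℚ[X]) :
    bernoulliUmbral (f.comp (1 + Polynomial.X)) =
      (bernoulliUmbral f).comp (1 + Polynomial.X) := by
  rw [← sub_left_inj (a := bernoulliUmbral f), bernoulliUmbral_shift_sub,
    bernoulliUmbral_comp_one_add_X_sub]

theorem bernoulliUmbral_comp_neg_X (f : ℚ[X]) :
    bernoulliUmbral (f.comp (-Polynomial.X)) =
      (bernoulliUmbral f).comp (1 - Polynomial.X) := by
  have h : bernoulliUmbral ∘ₗ compLinearMap (-Polynomial.X) =
      compLinearMap (1 - Polynomial.X) ∘ₗ bernoulliUmbral := by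
    refine linearMap_ext_X_pow fun r => ?_
    have h1 : (-Polynomial.X : ℚ[X]) ^ r = ((-1) ^ r : ℚ) • Polynomial.X ^ r := by
      rw [neg_pow, Polynomial.smul_eq_C_mul]; simp
    simp only [LinearMap.comp_apply, compLinearMap_apply, Polynomial.X_pow_comp, h1, map_smul,
      bernoulliUmbral_X_pow, Polynomial.bernoulli_comp_one_sub_X]
    simp [Polynomial.smul_eq_C_mul]
  simpa [compLinearMap_apply] using congr($h f)

/-! ### Chebyshev polynomials and the Zagier polynomials -/

theorem chebyshevC_comp_neg_X (n : ℕ) :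
    (Polynomial.Chebyshev.C ℚ n).comp (-Polynomial.X) =
      (-1) ^ n * Polynomial.Chebyshev.C ℚ n := by
  induction n using Nat.twoStepInduction with
  | zero => simp
  | one => simp
  | more n h1 h2 =>
    have h := Polynomial.Chebyshev.C_add_two ℚ (n : ℤ)
    push_cast at h2 ⊢
    rw [h, Polynomial.sub_comp, Polynomial.mul_comp, h1, h2, Polynomial.X_comp]
    ring

theorem derivative_chebyshevC (n : ℕ) :
    Polynomial.derivative (Polynomial.Chebyshev.C ℚ n) =
      n * Polynomial.Chebyshev.S ℚ (n - 1) := by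
  induction n using Nat.twoStepInduction with
  | zero => simp
  | one => simp
  | more n h1 h2 =>
    have h := Polynomial.Chebyshev.C_add_two ℚ (n : ℤ)
    have hS := Polynomial.Chebyshev.S_eq ℚ (n + 1 : ℤ)
    have hC := Polynomial.Chebyshev.S_eq_X_mul_S_add_C ℚ (n : ℤ)
    push_cast at h2 ⊢
    rw [h, Polynomial.derivative_sub, Polynomial.derivative_mul, h1, h2, Polynomial.derivative_X]
    have e1 : (n : ℤ) + 1 - 1 = n := by ring
    have e2 : (n : ℤ) + 1 - 2 = n - 1 := by ring
    have e3 : (n : ℤ) + 2 - 1 = n + 1 := by ring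
    rw [e1, e2] at hS
    rw [e1, e3]
    linear_combination -hC - (n : ℚ[X]) * hS

theorem coeff_chebyshevC_comp_X_add_two (n r : ℕ) :
    ((Polynomial.Chebyshev.C ℚ (n + 1 : ℕ)).comp (Polynomial.X + 2)).coeff r =
      ((n + 1 + r).choose (2 * r) + (n + r).choose (2 * r) : ℕ) := by
  induction n using Nat.twoStepInduction generalizing r with
  | zero =>
    rcases r with _ | _ | r
    · simp
    · simp [Polynomial.coeff_X]
    · rw [Nat.choose_eq_zero_of_lt (by omega), Nat.choose_eq_zero_of_lt (by omega)]
      simp [Polynomial.coeff_X]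
  | one =>
    have e : (Polynomial.Chebyshev.C ℚ (1 + 1 : ℕ)).comp (Polynomial.X + 2) =
        Polynomial.X ^ 2 + Polynomial.C 4 * Polynomial.X + Polynomial.C 2 := by
      have : ((1 + 1 : ℕ) : ℤ) = 2 := by norm_num
      rw [this, Polynomial.Chebyshev.C_two, map_ofNat, map_ofNat]
      simp
      ring
    rw [e]
    rcases r with _ | _ | _ | r
    · simp
    · simp [Polynomial.coeff_C, Polynomial.coeff_X_pow]
    · simp [Polynomial.coeff_X_pow]
    · rw [Nat.choose_eq_zero_of_lt (by omega), Nat.choose_eq_zero_of_lt (by omega)]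
      simp [Polynomial.coeff_X_pow]
  | more n h1 h2 =>
    have e : (Polynomial.Chebyshev.C ℚ (n + 2 + 1 : ℕ)).comp (Polynomial.X + 2) =
        Polynomial.X * (Polynomial.Chebyshev.C ℚ (n + 1 + 1 : ℕ)).comp (Polynomial.X + 2)
        + Polynomial.C 2 * (Polynomial.Chebyshev.C ℚ (n + 1 + 1 : ℕ)).comp (Polynomial.X + 2)
        - (Polynomial.Chebyshev.C ℚ (n + 1 : ℕ)).comp (Polynomial.X + 2) := by
      have h := Polynomial.Chebyshev.C_add_two ℚ (n + 1 : ℤ)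
      have e1 : ((n + 2 + 1 : ℕ) : ℤ) = n + 1 + 2 := by push_cast; ring
      rw [e1, h, map_ofNat]
      simp
      ring
    rw [e, Polynomial.coeff_sub, Polynomial.coeff_add, Polynomial.coeff_C_mul, h1, h2]
    rcases r with _ | r
    · simp; norm_num
    · rw [Polynomial.coeff_X_mul, h2]
      -- Second difference of binomials, matching C_{n+2}(X+2) - 2C_{n+1}(X+2) + C_n(X+2) = X
      -- C_{n+1}(X+2).
      have pascal : ∀ m k : ℕ, (m + 1 + 1).choose (k + 2) + m.choose (k + 2) =
          m.choose k + 2 * (m + 1).choose (k + 2) := fun m k => by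
        simp only [Nat.choose_succ_succ' (m + 1), Nat.choose_succ_succ' m]; ring
      have p1 := pascal (n + 1 + r + 1) (2 * r)
      have p2 := pascal (n + 1 + r) (2 * r)
      rw [sub_eq_iff_eq_add]
      norm_cast
      rw [show n + 2 + 1 + (r + 1) = n + 1 + r + 1 + 1 + 1 by ring,
        show n + 2 + (r + 1) = n + 1 + r + 1 + 1 by ring,
        show n + 1 + 1 + r = n + 1 + r + 1 by ring,
        show n + 1 + (r + 1) = n + 1 + r + 1 by ring,
        show n + (r + 1) = n + 1 + r by ring,
        show 2 * (r + 1) = 2 * r + 2 by ring]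
      omega

theorem zagierPolynomial_eq_bernoulliUmbral (n : ℕ) :
    (2 * ((n : ℚ) + 1)) • zagierPolynomial (n + 1) =
      bernoulliUmbral ((Polynomial.Chebyshev.C ℚ (n + 1 : ℕ)).comp (Polynomial.X + 2)) := by
  set p := (Polynomial.Chebyshev.C ℚ (n + 1 : ℕ)).comp (Polynomial.X + 2) with hp
  have hdeg : p.natDegree < n + 1 + 1 := by
    refine Nat.lt_succ_of_le (Polynomial.natDegree_le_iff_coeff_eq_zero.mpr fun r hr => ?_)
    rw [hp, coeff_chebyshevC_comp_X_add_two, Nat.choose_eq_zero_of_lt (by omega),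
      Nat.choose_eq_zero_of_lt (by omega)]
    simp
  rw [p.as_sum_range_C_mul_X_pow' hdeg, zagierPolynomial, map_sum, Finset.smul_sum]
  refine Finset.sum_congr rfl fun r _ => ?_
  rw [← Polynomial.smul_eq_C_mul, ← Polynomial.smul_eq_C_mul, map_smul, bernoulliUmbral_X_pow,
    smul_smul, hp, coeff_chebyshevC_comp_X_add_two]
  congr 1
  have h1 : (n + r + 1).choose (2 * r) * (n + 1 + r - 2 * r) = (n + r).choose (2 * r) * (n + r + 1) := by
    have := Nat.choose_mul_succ_eq (n + r) (2 * r)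
    rw [this]
    congr 1
    omega
  have h2 : ((n + r + 1).choose (2 * r) : ℚ) * (n + 1 - r) =
      (n + r).choose (2 * r) * (n + r + 1) := by
    rcases le_or_gt r (n + 1) with h | h
    · have e : n + 1 + r - 2 * r = n + 1 - r := by omega
      rw [e] at h1
      have := congrArg (Nat.cast (R := ℚ)) h1
      push_cast [Nat.cast_sub h] at this
      exact this
    · rw [Nat.choose_eq_zero_of_lt (by omega), Nat.choose_eq_zero_of_lt (by omega)]
      simp
  have e : n + 1 + r = n + r + 1 := by ring
  rw [e]
  have h3 : ((n : ℚ) + r + 1) ≠ 0 := by positivity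
  push_cast
  field_simp
  linear_combination h2


/-! ### Rational power series -/

namespace IsRationalFunction

variable {K : Type*} [Field K] {F G : K⟦X⟧}

theorem add (hF : IsRationalFunction F) (hG : IsRationalFunction G) :
    IsRationalFunction (F + G) := by
  obtain ⟨P, Q, hQ, h⟩ := hF
  obtain ⟨P', Q', hQ', h'⟩ := hG
  refine ⟨P * Q' + P' * Q, Q * Q', mul_ne_zero hQ hQ', ?_⟩
  push_cast
  rw [← h, ← h']
  ring

theorem smul (c : K) (hF : IsRationalFunction F) : IsRationalFunction (c • F) := by
  obtain ⟨P, Q, hQ, h⟩ := hF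
  refine ⟨Polynomial.C c * P, Q, hQ, ?_⟩
  push_cast
  rw [← h, PowerSeries.smul_eq_C_mul]
  ring

theorem neg (hF : IsRationalFunction F) : IsRationalFunction (-F) := by
  simpa using hF.smul (-1)

theorem sub (hF : IsRationalFunction F) (hG : IsRationalFunction G) :
    IsRationalFunction (F - G) := by
  rw [sub_eq_add_neg]
  exact hF.add hG.neg

/-- The coefficients of a rational power series grow at most exponentially. -/
theorem exists_abs_coeff_le {F : ℝ⟦X⟧} (hF : IsRationalFunction F) :
    ∃ K R : ℝ, 0 ≤ K ∧ 1 ≤ R ∧ ∀ m, |PowerSeries.coeff m F| ≤ K * R ^ m := by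
  obtain ⟨P, Q, hQ, h⟩ := hF
  set k := Q.natTrailingDegree with hk
  set q := Q.coeff k with hq
  have hq0 : q ≠ 0 := by
    rw [hq, hk]
    exact Polynomial.trailingCoeff_nonzero_iff_nonzero.mpr hQ
  have hqp : 0 < |q| := abs_pos.mpr hq0
  set A := ∑ i ∈ Finset.range (P.natDegree + 1), |P.coeff i| with hA
  set S := ∑ i ∈ Finset.range (Q.natDegree + 1), |Q.coeff i| with hS
  have hA0 : 0 ≤ A := Finset.sum_nonneg fun _ _ => abs_nonneg _
  have hS0 : 0 ≤ S := Finset.sum_nonneg fun _ _ => abs_nonneg _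
  have hPA : ∀ i, |P.coeff i| ≤ A := fun i => by
    by_cases hi : i ∈ Finset.range (P.natDegree + 1)
    · exact Finset.single_le_sum (f := fun i => |P.coeff i|) (fun _ _ => abs_nonneg _) hi
    · rw [Polynomial.coeff_eq_zero_of_natDegree_lt (by simpa [Nat.lt_succ_iff] using hi), abs_zero]
      exact hA0
  have hSum : ∀ s : Finset ℕ, ∑ i ∈ s, |Q.coeff i| ≤ S := fun s => by
    rw [hS, ← Finset.sum_subset (s₁ := s ∩ Finset.range (Q.natDegree + 1))
      Finset.inter_subset_left]
    · exact Finset.sum_le_sum_of_subset_of_nonneg Finset.inter_subset_right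
        fun _ _ _ => abs_nonneg _
    · intro i hi hi'
      rw [Polynomial.coeff_eq_zero_of_natDegree_lt, abs_zero]
      simp only [Finset.mem_inter, hi, true_and, Finset.mem_range] at hi'
      omega
  have hK0 : 0 ≤ A / |q| := by positivity
  have hR1 : 1 ≤ 1 + S / |q| := by
    have : 0 ≤ S / |q| := by positivity
    linarith
  refine ⟨A / |q|, 1 + S / |q|, hK0, hR1, fun m => ?_⟩
  set K := A / |q|
  set R := 1 + S / |q| with hR
  induction m using Nat.strong_induction_on with
  | _ m ih =>
  -- Since k is the order of Q at 0, this coefficient expresses q times the m-th coefficient of F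
  -- through earlier ones.
  have hc := congrArg (PowerSeries.coeff (k + m)) h
  rw [PowerSeries.coeff_mul, Finset.Nat.sum_antidiagonal_eq_sum_range_succ_mk,
    ← Finset.sum_erase_add _ _ (Finset.mem_range.mpr (show k < (k + m).succ by omega))] at hc
  simp only [Polynomial.coeff_coe, Nat.add_sub_cancel_left, ← hq] at hc
  have hbound : |∑ i ∈ (Finset.range (k + m).succ).erase k,
      Q.coeff i * PowerSeries.coeff (k + m - i) F| ≤ S * (K * R ^ (m - 1)) := by
    refine (Finset.abs_sum_le_sum_abs _ _).trans ?_
    refine le_trans (Finset.sum_le_sum (g := fun i => |Q.coeff i| * (K * R ^ (m - 1))) ?_) ?_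
    · intro i hi
      rw [Finset.mem_erase, Finset.mem_range] at hi
      rw [abs_mul]
      rcases lt_or_ge i k with hik | hik
      · rw [Polynomial.coeff_eq_zero_of_lt_natTrailingDegree hik]
        simp
      · refine mul_le_mul_of_nonneg_left ((ih _ (by omega)).trans ?_) (abs_nonneg _)
        refine mul_le_mul_of_nonneg_left (pow_le_pow_right₀ hR1 (by omega)) hK0
    · rw [← Finset.sum_mul]
      exact mul_le_mul_of_nonneg_right (hSum _) (by positivity)
  have h1 : |q| * |PowerSeries.coeff m F| ≤ A + S * (K * R ^ (m - 1)) := by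
    rw [← abs_mul, eq_sub_of_add_eq' hc]
    refine (abs_sub _ _).trans (add_le_add (hPA _) hbound)
  rcases m with _ | m
  · have h0 : (Finset.range (k + 0).succ).erase k = Finset.range k := by
      ext i; simp; omega
    rw [h0, Finset.sum_eq_zero fun i hi => by
      rw [Polynomial.coeff_eq_zero_of_lt_natTrailingDegree (Finset.mem_range.mp hi), zero_mul],
      zero_add] at hc
    rw [pow_zero, mul_one, le_div_iff₀ hqp, ← abs_mul, mul_comm, hc]
    exact hPA _
  · rw [Nat.add_sub_cancel] at h1
    have h2 : |PowerSeries.coeff (m + 1) F| ≤ K + S / |q| * (K * R ^ m) := by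
      rw [← mul_le_mul_iff_right₀ hqp]
      refine h1.trans (le_of_eq ?_)
      simp only [K]
      field_simp
    have h3 : K ≤ K * R ^ m := le_mul_of_one_le_right hK0 (one_le_pow₀ hR1)
    calc _ ≤ K + S / |q| * (K * R ^ m) := h2
      _ ≤ K * R ^ m + S / |q| * (K * R ^ m) := by linarith
      _ = K * R ^ (m + 1) := by rw [hR]; ring

end IsRationalFunction

/-- A power series whose coefficients satisfy a recurrence of the form
`c (m + 4) = a * c (m + 2) - c m` is rational. -/
theorem isRationalFunction_mk_of_recurrence {K : Type*} [Field K] (c : ℕ → K) (a : K)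
    (h : ∀ m, c (m + 4) = a * c (m + 2) - c m) : IsRationalFunction (PowerSeries.mk c) := by
  set Q : K[X] := 1 - Polynomial.C a * Polynomial.X ^ 2 + Polynomial.X ^ 4 with hQ
  have hQ0 : Q ≠ 0 := fun h0 => by
    have := congrArg (fun p => Polynomial.coeff p 0) h0
    simp [hQ] at this
  -- The recurrence kills every coefficient of the product from degree 4 on.
  refine ⟨PowerSeries.trunc 4 ((Q : K⟦X⟧) * PowerSeries.mk c), Q, hQ0, ?_⟩
  ext n
  rw [Polynomial.coeff_coe, PowerSeries.coeff_trunc]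
  split_ifs with hn
  · rfl
  · obtain ⟨m, rfl⟩ := Nat.exists_eq_add_of_le' (not_lt.mp hn)
    have e : (Q : K⟦X⟧) = 1 - PowerSeries.C a * PowerSeries.X ^ 2 + PowerSeries.X ^ 4 := by
      simp [hQ]
    have h2 : PowerSeries.coeff (m + 4) (PowerSeries.X ^ 2 * PowerSeries.mk c) = c (m + 2) := by
      rw [show m + 4 = m + 2 + 2 by ring, PowerSeries.coeff_X_pow_mul, PowerSeries.coeff_mk]
    rw [e, add_mul, sub_mul, one_mul, mul_assoc, map_add, map_sub, PowerSeries.coeff_C_mul, h2,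
      PowerSeries.coeff_X_pow_mul, PowerSeries.coeff_mk, PowerSeries.coeff_mk, h]
    ring

/-! ### Growth of odd Bernoulli polynomials -/

open Filter Topology in
/-- At a point `y ∈ [0, 1]` with `sin (2πy) ≠ 0`, the odd Bernoulli polynomials grow
superexponentially. -/
theorem not_abs_bernoulli_odd_le {y : ℝ} (hy : y ∈ Set.Icc (0 : ℝ) 1)
    (hsin : Real.sin (2 * Real.pi * y) ≠ 0) (K R : ℝ) :
    ¬ ∀ k : ℕ, |Polynomial.aeval y (Polynomial.bernoulli (2 * k + 1))| ≤ K * R ^ (2 * k + 1) := by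
  intro hb
  -- In the Fourier series only the n = 1 term survives as k → ∞.
  have h1 : Tendsto (fun k : ℕ => ∑' n : ℕ,
      1 / (n : ℝ) ^ (2 * (k + 1) + 1) * Real.sin (2 * Real.pi * n * y)) atTop
      (𝓝 (∑' n : ℕ, if n = 1 then Real.sin (2 * Real.pi * y) else 0)) := by
    refine tendsto_tsum_of_dominated_convergence (bound := fun n : ℕ => 1 / (n : ℝ) ^ 2)
      (Real.summable_one_div_nat_pow.mpr (by norm_num)) (fun n => ?_) (Eventually.of_forall ?_)
    · rcases n with _ | _ | n
      · simp
      · simp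
      · have h0 : Tendsto (fun k : ℕ => (1 / ((n + 1 + 1 : ℕ) : ℝ)) ^ (2 * (k + 1) + 1)) atTop
            (𝓝 0) := by
          refine (tendsto_pow_atTop_nhds_zero_of_lt_one (by positivity) ?_).comp
            (tendsto_atTop_mono (fun k => ?_) tendsto_id)
          · rw [div_lt_one (by positivity)]
            push_cast
            have : (0 : ℝ) ≤ n := Nat.cast_nonneg n
            linarith
          · simp only [id]; omega
        have h0' := h0.mul_const (Real.sin (2 * Real.pi * ((n + 1 + 1 : ℕ) : ℝ) * y))
        rw [zero_mul] at h0'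
        rw [if_neg (by omega)]
        simpa only [one_div, inv_pow] using h0'
    · intro k n
      rcases Nat.eq_zero_or_pos n with rfl | hn
      · simp
      · have hn1 : (1 : ℝ) ≤ n := by exact_mod_cast hn
        rw [norm_mul, Real.norm_eq_abs, Real.norm_eq_abs, abs_of_nonneg (by positivity)]
        calc _ ≤ 1 / (n : ℝ) ^ (2 * (k + 1) + 1) * 1 :=
              mul_le_mul_of_nonneg_left (Real.abs_sin_le_one _) (by positivity)
          _ ≤ 1 / (n : ℝ) ^ 2 := by
              rw [mul_one]
              exact one_div_le_one_div_of_le (by positivity)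
                (pow_le_pow_right₀ hn1 (by omega))
  rw [tsum_ite_eq] at h1
  -- The sum is ±(2π)^j B_j(y) / (2 j!) with j = 2(k+1)+1; under the assumed bound the factorial
  -- wins.
  have h2 : Tendsto (fun k : ℕ => ∑' n : ℕ,
      1 / (n : ℝ) ^ (2 * (k + 1) + 1) * Real.sin (2 * Real.pi * n * y)) atTop (𝓝 0) := by
    have hf := ((FloorSemiring.tendsto_pow_div_factorial_atTop (2 * Real.pi * R)).comp
      (tendsto_atTop_mono (f := id) (g := fun k : ℕ => 2 * (k + 1) + 1)
        (fun k => by simp only [id]; omega) tendsto_id)).const_mul (K / 2)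
    rw [mul_zero] at hf
    refine squeeze_zero_norm (fun k => ?_) hf
    rw [(hasSum_one_div_nat_pow_mul_sin (Nat.succ_ne_zero k) hy).tsum_eq,
      Polynomial.eval_map_algebraMap, norm_mul, norm_div, norm_div, norm_mul, norm_pow, norm_neg,
      norm_one, one_pow, one_mul, Real.norm_eq_abs _, Real.norm_eq_abs _, Real.norm_eq_abs _,
      Real.norm_eq_abs _, abs_of_nonneg (by positivity : (0:ℝ) ≤ (2 * Real.pi) ^ _),
      abs_of_nonneg (by norm_num : (0 : ℝ) ≤ 2), Nat.abs_cast]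
    refine (mul_le_mul_of_nonneg_left (hb (k + 1)) (by positivity)).trans (le_of_eq ?_)
    simp only [Function.comp_apply, Nat.succ_eq_add_one]
    rw [mul_pow (2 * Real.pi) R]
    ring
  exact hsin (tendsto_nhds_unique h1 h2)


/-! ### Reflection and translation of the generating function -/

/-- The Zagier polynomials at `x` in terms of the Chebyshev polynomials at `x + 2`. -/
theorem aeval_zagierPolynomial (n : ℕ) (x : ℝ) :
    2 * ((n : ℝ) + 1) * Polynomial.aeval x (zagierPolynomial (n + 1)) =
      Polynomial.aeval (x + 2) (bernoulliUmbral (Polynomial.Chebyshev.C ℚ (n + 1 : ℕ))) := by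
  have h := zagierPolynomial_eq_bernoulliUmbral n
  have e : (Polynomial.Chebyshev.C ℚ (n + 1 : ℕ)).comp (Polynomial.X + 2) =
      ((Polynomial.Chebyshev.C ℚ (n + 1 : ℕ)).comp (1 + Polynomial.X)).comp (1 + Polynomial.X) := by
    rw [Polynomial.comp_assoc]
    congr 1
    simp
    ring
  rw [e, bernoulliUmbral_comp_one_add_X, bernoulliUmbral_comp_one_add_X] at h
  have h' := congrArg (Polynomial.aeval x) h
  rw [map_smul, Polynomial.aeval_comp, Polynomial.aeval_comp, Algebra.smul_def] at h'
  simp only [map_add, map_one, map_mul, map_natCast, map_ofNat, Polynomial.aeval_X] at h'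
  rw [h']
  congr 2
  ring

theorem aeval_one_sub_bernoulliUmbral_chebyshevC {n : ℕ} (hn : Odd n) (y : ℝ) :
    Polynomial.aeval (1 - y) (bernoulliUmbral (Polynomial.Chebyshev.C ℚ n)) =
      -Polynomial.aeval y (bernoulliUmbral (Polynomial.Chebyshev.C ℚ n)) := by
  have h := bernoulliUmbral_comp_neg_X (Polynomial.Chebyshev.C ℚ n)
  rw [chebyshevC_comp_neg_X, hn.neg_one_pow, neg_one_mul, map_neg] at h
  have h' := congrArg (Polynomial.aeval y) h
  rw [Polynomial.aeval_comp] at h'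
  simpa using h'.symm

theorem coeff_oddZagierGenFun_succ (x : ℝ) (n : ℕ) :
    PowerSeries.coeff (n + 1) (oddZagierGenFun x) = if Odd (n + 1) then
      Polynomial.aeval (x + 2) (bernoulliUmbral (Polynomial.Chebyshev.C ℚ (n + 1 : ℕ))) /
        (2 * ((n : ℝ) + 1)) else 0 := by
  rw [oddZagierGenFun, PowerSeries.coeff_mk]
  have : (2 * ((n : ℝ) + 1)) ≠ 0 := by positivity
  rw [← aeval_zagierPolynomial, mul_div_cancel_left₀ _ this]

theorem constantCoeff_oddZagierGenFun (x : ℝ) :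
    PowerSeries.constantCoeff (oddZagierGenFun x) = 0 := by
  rw [← PowerSeries.coeff_zero_eq_constantCoeff_apply, oddZagierGenFun, PowerSeries.coeff_mk]
  simp

theorem oddZagierGenFun_neg_three_sub (x : ℝ) :
    oddZagierGenFun (-3 - x) = -oddZagierGenFun x := by
  ext m
  rcases m with _ | n
  · simp [constantCoeff_oddZagierGenFun]
  · rw [map_neg, coeff_oddZagierGenFun_succ, coeff_oddZagierGenFun_succ]
    split_ifs with h
    · rw [show -3 - x + 2 = 1 - (x + 2) by ring, aeval_one_sub_bernoulliUmbral_chebyshevC h, neg_div]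
    · simp

theorem oddZagierGenFun_add_one_sub (x : ℝ) :
    oddZagierGenFun (x + 1) - oddZagierGenFun x = PowerSeries.mk fun m : ℕ =>
      if Odd m then (Polynomial.Chebyshev.S ℝ (m - 1)).eval (x + 2) / 2 else 0 := by
  ext m
  rcases m with _ | n
  · simp [constantCoeff_oddZagierGenFun]
  · rw [map_sub, coeff_oddZagierGenFun_succ, coeff_oddZagierGenFun_succ, PowerSeries.coeff_mk]
    split_ifs with h
    · have h1 := congrArg (Polynomial.aeval (x + 2)) (bernoulliUmbral_comp_one_add_X_sub
        (Polynomial.Chebyshev.C ℚ (n + 1 : ℕ)))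
      rw [derivative_chebyshevC, map_sub, Polynomial.aeval_comp, map_mul,
        Polynomial.Chebyshev.aeval_S] at h1
      simp only [map_add, map_one, map_natCast, Polynomial.aeval_X] at h1
      rw [← sub_div, show x + 1 + 2 = 1 + (x + 2) by ring, h1]
      push_cast
      field_simp
    · simp

theorem isRationalFunction_oddZagierGenFun_add_one_sub (x : ℝ) :
    IsRationalFunction (oddZagierGenFun (x + 1) - oddZagierGenFun x) := by
  rw [oddZagierGenFun_add_one_sub]
  -- With x + 2 = t + 1/t, the multiplier is t² + t⁻², giving the two-step recurrence of S.
  refine isRationalFunction_mk_of_recurrence _ ((x + 2) ^ 2 - 2) fun m => ?_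
  have h4 : Odd (m + 4) ↔ Odd m := by simp [Nat.odd_add, show Even 4 by decide]
  have h2 : Odd (m + 2) ↔ Odd m := by simp [Nat.odd_add]
  simp only [h4, h2]
  split_ifs
  · have e1 := Polynomial.Chebyshev.S_add_two ℝ (m + 1 : ℤ)
    have e2 := Polynomial.Chebyshev.S_add_two ℝ (m : ℤ)
    have e3 := Polynomial.Chebyshev.S_add_one ℝ (m : ℤ)
    have e4 := congrArg (Polynomial.eval (x + 2)) e1
    have e5 := congrArg (Polynomial.eval (x + 2)) e2
    have e6 := congrArg (Polynomial.eval (x + 2)) e3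
    simp only [Polynomial.eval_sub, Polynomial.eval_mul, Polynomial.eval_X] at e4 e5 e6
    push_cast
    rw [show (m : ℤ) + 4 - 1 = m + 1 + 2 by ring, show (m : ℤ) + 2 - 1 = m + 1 by ring]
    rw [show (m : ℤ) + 1 + 1 = m + 2 by ring] at e4
    linear_combination e4 / 2 + (x + 2) / 2 * e5 + e6 / 2
  · simp

theorem isRationalFunction_oddZagierGenFun_add_int_sub (x : ℝ) (k : ℤ) :
    IsRationalFunction (oddZagierGenFun (x + k) - oddZagierGenFun x) := by
  induction k with
  | zero => exact ⟨0, 1, one_ne_zero, by simp⟩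
  | succ k ih =>
    have h := (isRationalFunction_oddZagierGenFun_add_one_sub (x + k)).add ih
    push_cast at h ⊢
    rwa [sub_add_sub_cancel, add_assoc] at h
  | pred k ih =>
    have h := ih.sub (isRationalFunction_oddZagierGenFun_add_one_sub (x + (-k - 1)))
    push_cast at h ⊢
    rwa [add_assoc x, sub_add_cancel, sub_sub_sub_cancel_left] at h

/-! ### From coefficient bounds to Bernoulli bounds -/

/-- Exponential bounds on a linear functional at the odd Chebyshev polynomials `C` yield
exponential bounds at the odd monomials. -/
theorem abs_X_pow_mul_chebyshevC_le (φ : ℚ[X] →+ ℝ) {K R : ℝ} (hK : 0 ≤ K) (hR : 1 ≤ R)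
    (h : ∀ n : ℤ, Odd n → |φ (Polynomial.Chebyshev.C ℚ n)| ≤ K * R ^ n.natAbs) (m : ℕ) (n : ℤ)
    (hmn : Odd (n + m)) :
    |φ (Polynomial.X ^ m * Polynomial.Chebyshev.C ℚ n)| ≤ K * 2 ^ m * R ^ (n.natAbs + m) := by
  induction m generalizing n with
  | zero => simpa using h n (by simpa using hmn)
  | succ m ih =>
    -- X C_n = C_{n+1} + C_{n-1}; indices may turn negative, hence n ∈ ℤ.
    have e : Polynomial.X ^ (m + 1) * Polynomial.Chebyshev.C ℚ n =
        Polynomial.X ^ m * Polynomial.Chebyshev.C ℚ (n + 1) +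
          Polynomial.X ^ m * Polynomial.Chebyshev.C ℚ (n - 1) := by
      rw [Polynomial.Chebyshev.C_add_one]
      ring
    push_cast at hmn
    have h1 := ih (n + 1) (by rwa [add_right_comm, add_assoc])
    have h2 := ih (n - 1) (by
      have : n - 1 + m = n + (m + 1) - 2 := by ring
      rw [this]
      exact hmn.sub_even even_two)
    have hle : ∀ j : ℤ, j.natAbs ≤ n.natAbs + 1 →
        K * 2 ^ m * R ^ (j.natAbs + m) ≤ K * 2 ^ m * R ^ (n.natAbs + (m + 1)) := fun j hj =>
      mul_le_mul_of_nonneg_left (pow_le_pow_right₀ hR (by omega)) (by positivity)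
    rw [e, map_add]
    refine (abs_add_le _ _).trans ?_
    have h3 := h1.trans (hle (n + 1) (by omega))
    have h4 := h2.trans (hle (n - 1) (by omega))
    calc _ ≤ _ := add_le_add h3 h4
      _ = _ := by ring

theorem exists_abs_bernoulli_odd_le {y : ℝ}
    (hy : IsRationalFunction (oddZagierGenFun (y - 2))) :
    ∃ K R : ℝ, ∀ k : ℕ,
      |Polynomial.aeval y (Polynomial.bernoulli (2 * k + 1))| ≤ K * R ^ (2 * k + 1) := by
  obtain ⟨K, R, hK, hR, h⟩ := hy.exists_abs_coeff_le
  have hC : ∀ n : ℤ, Odd n → |Polynomial.aeval y (bernoulliUmbral (Polynomial.Chebyshev.C ℚ n))| ≤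
      2 * K * (2 * R) ^ n.natAbs := by
    intro n hn
    rw [← Polynomial.Chebyshev.C_natAbs]
    rw [← Int.natAbs_odd] at hn
    generalize n.natAbs = m at hn
    rcases m with _ | m
    · simp at hn
    · have h1 := h (m + 1)
      rw [coeff_oddZagierGenFun_succ, if_pos hn, sub_add_cancel, abs_div,
        abs_of_pos (by positivity : 0 < 2 * ((m : ℝ) + 1)), div_le_iff₀ (by positivity)] at h1
      -- Absorbs the denominator 2(m + 1) of the coefficient into the exponential.
      have h2 : (m : ℝ) + 1 ≤ 2 ^ (m + 1) := by
        exact_mod_cast (Nat.lt_two_pow_self (n := m + 1)).le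
      refine h1.trans ?_
      rw [mul_pow]
      have : 0 ≤ K * R ^ (m + 1) := by positivity
      nlinarith [mul_le_mul_of_nonneg_left h2 this]
  refine ⟨K, 4 * R, fun k => ?_⟩
  -- Taking n = 0 isolates the monomial, since C_0 = 2.
  have h1 := abs_X_pow_mul_chebyshevC_le
    ((Polynomial.aeval y : ℚ[X] →ₐ[ℚ] ℝ).toLinearMap ∘ₗ bernoulliUmbral).toAddMonoidHom
    (by positivity : 0 ≤ 2 * K) (by linarith : 1 ≤ 2 * R) hC (2 * k + 1) 0 (by simp)
  have e : bernoulliUmbral (Polynomial.X ^ (2 * k + 1) * Polynomial.Chebyshev.C ℚ 0) =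
      (2 : ℚ) • Polynomial.bernoulli (2 * k + 1) := by
    rw [Polynomial.Chebyshev.C_zero, ← bernoulliUmbral_X_pow, ← map_smul,
      Polynomial.smul_eq_C_mul, map_ofNat, mul_comm]
  simp only [LinearMap.toAddMonoidHom_coe, LinearMap.comp_apply, AlgHom.toLinearMap_apply, e,
    map_smul] at h1
  rw [Algebra.smul_def, map_ofNat, abs_mul, abs_of_pos (by norm_num : (0 : ℝ) < 2), Int.natAbs_zero,
    zero_add] at h1
  have e2 : 2 * K * 2 ^ (2 * k + 1) * (2 * R) ^ (2 * k + 1) = 2 * (K * (4 * R) ^ (2 * k + 1)) := by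
    rw [show 4 * R = 2 * (2 * R) by ring, mul_pow 2 (2 * R)]
    ring
  linarith

theorem theorem11p4 (x : ℝ) :
    IsRationalFunction (oddZagierGenFun x) ↔ ∃ k : ℤ, 2 * x = (k : ℝ) := by
  constructor
  · intro h
    by_contra hx
    have hshift : IsRationalFunction (oddZagierGenFun (Int.fract x - 2)) := by
      have h1 := (isRationalFunction_oddZagierGenFun_add_int_sub x (-⌊x⌋ - 2)).add h
      rw [sub_add_cancel] at h1
      have e : x + ((-⌊x⌋ - 2 : ℤ) : ℝ) = Int.fract x - 2 := by
        rw [Int.fract]; push_cast; ring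
      rwa [e] at h1
    obtain ⟨K, R, hKR⟩ := exists_abs_bernoulli_odd_le hshift
    refine not_abs_bernoulli_odd_le ⟨Int.fract_nonneg x, (Int.fract_lt_one x).le⟩ ?_ K R hKR
    intro hs
    obtain ⟨n, hn⟩ := Real.sin_eq_zero_iff.mp hs
    refine hx ⟨n + 2 * ⌊x⌋, ?_⟩
    have hn' : (n : ℝ) = 2 * Int.fract x := by
      refine mul_right_cancel₀ Real.pi_ne_zero ?_
      rw [hn]; ring
    push_cast
    rw [hn', Int.fract]
    ring
  · rintro ⟨k, hk⟩
    have h := isRationalFunction_oddZagierGenFun_add_int_sub (-3 - x) (k + 3)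
    have e : -3 - x + ((k + 3 : ℤ) : ℝ) = x := by push_cast; linarith
    rw [e, oddZagierGenFun_neg_three_sub, sub_neg_eq_add, ← two_smul ℝ] at h
    have h' := h.smul (1 / 2)
    rw [smul_smul] at h'
    simpa using h'
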